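/- Let $\lambda$ be an infinite regular cardinal and let $\mathcal{C}$ be a locally $\lambda$-presentable additive category. Call a morphism $f : A \to B$ of $\mathcal{C}$ \emph{$\lambda$-pure} if for every morphism $g : X \to Y$ between $\lambda$-presentable objects of $\mathcal{C}$ and every $u : X \to A$ such that $fu$ factors through $g$, the morphism $u$ itself factors through $g$. Call a full subcategory $\mathcal{D} \subseteq \mathcal{C}$ \emph{$\lambda$-definable} if it is closed under (small) products, under $\lambda$-directed colimits, and under $\lambda$-pure subobjects (if $f : A \to B$ is $\lambda$-pure and $B \in \mathcal{D}$, then $A \in \mathcal{D}$). Let $\mathrm{fun}_\lambda\,\mathcal{C}$ be the category of functors $\mathcal{C} \to \mathbf{Ab}$ which preserve $\lambda$-directed colimits and (small) products. A full subcategory $\mathcal{D} \subseteq \mathcal{C}$ is $\lambda$-definable if and only if there is a full subcategory $\mathcal{F} \subseteq \mathrm{fun}_\lambda\,\mathcal{C}$ such that \[ \mathcal{D} = \{\, C \in \mathcal{C} : FC = 0 \text{ for all } F \in \mathcal{F} \,\}. \] -/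

import Mathlib

universe w v u

open CategoryTheory CategoryTheory.Limits

namespace LambdaDefinable

/-- A morphism `f : A ⟶ B` is `κ`-pure if, for every morphism `g : X ⟶ Y` between `κ`-presentable
objects and every `a : X ⟶ A`, if `a ≫ f` factors through `g`, then so does `a`. -/
def IsPure {C : Type u} [Category.{v} C] (κ : Cardinal.{w}) [Fact κ.IsRegular]
    {A B : C} (f : A ⟶ B) : Prop :=
  ∀ ⦃X Y : C⦄ (g : X ⟶ Y), IsCardinalPresentable X κ → IsCardinalPresentable Y κ →
    ∀ a : X ⟶ A, (∃ b : Y ⟶ B, g ≫ b = a ≫ f) → ∃ c : Y ⟶ A, g ≫ c = a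

/-- A full subcategory `D` of `C` (given by its class of objects) is `κ`-definable if it is closed
under products, `κ`-directed colimits and `κ`-pure subobjects in `C`. For a partially ordered set
`J`, `IsCardinalFiltered J κ` says that every family of fewer than `κ` elements of `J` has an
upper bound. -/
structure IsDefinable {C : Type u} [Category.{v} C] (κ : Cardinal.{w}) [Fact κ.IsRegular]
    (D : ObjectProperty C) : Prop where
  closed_products (ι : Type w) : D.IsClosedUnderLimitsOfShape (Discrete ι)
  closed_directed_colimits (J : Type w) [PartialOrder J] [IsCardinalFiltered J κ] :
    D.IsClosedUnderColimitsOfShape J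
  closed_pure_subobjects ⦃A B : C⦄ (f : A ⟶ B) : IsPure κ f → D B → D A

/-- The class of functors `C ⥤ Ab` which preserve `κ`-directed colimits and products. -/
structure IsFun {C : Type u} [Category.{v} C] (κ : Cardinal.{w}) [Fact κ.IsRegular]
    (F : C ⥤ AddCommGrpCat.{w}) : Prop where
  preserves_directed_colimits (J : Type w) [PartialOrder J] [IsCardinalFiltered J κ] :
    PreservesColimitsOfShape J F
  preserves_products (ι : Type w) : PreservesLimitsOfShape (Discrete ι) F

/-- The category `fun_κ C` of functors `C ⥤ Ab` which preserve `κ`-directed colimits and products,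
as a full subcategory of the category of all functors. -/
abbrev FunCat (C : Type u) [Category.{v} C] (κ : Cardinal.{w}) [Fact κ.IsRegular] :=
  ObjectProperty.FullSubcategory
    (fun F : C ⥤ AddCommGrpCat.{w} => IsFun κ F)

end LambdaDefinable

/-! For `g : X ⟶ Y` between `κ`-presentable objects, the cokernel of `Hom(Y, -) ⟶ Hom(X, -)` lies in
`FunCat C κ` and vanishes exactly on the `g`-injective objects. Hence it suffices that a definable
`D` contains every `A` injective for all `g` for which `D` is injective
(`IsDefinable.prop_of_injective`). Such an `A` is a pure subobject of a product of objects of `D`,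
since `exists_hom_not_factoring` detects each non-factorization in some object of `D`. Conversely,
zero classes are closed under pure subobjects because these functors send pure morphisms to
injections (`IsPure.map_injective`). -/

namespace LambdaDefinable

/-! ### Presentability background -/

/-- Locally presentable categories are complete. -/
lemma hasLimitsOfSize_of_isCardinalLocallyPresentable (C : Type u) [Category.{w} C]
    (κ : Cardinal.{w}) [Fact κ.IsRegular] [IsCardinalLocallyPresentable C κ] :
    HasLimitsOfSize.{w, w} C := by
  let e := equivSmallModel.{w} (isCardinalPresentable C κ).FullSubcategory
  let A : SmallModel.{w} (isCardinalPresentable C κ).FullSubcategory ⥤ C :=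
    e.inverse ⋙ (isCardinalPresentable C κ).ι
  let R := Presheaf.restrictedULiftYoneda.{w} A
  let L := (uliftYoneda.{w}).leftKanExtension A
  have adj : L ⊣ R :=
    Presheaf.uliftYonedaAdjunction.{w} L ((uliftYoneda.{w}).leftKanExtensionUnit A)
  -- The `κ`-presentable objects are dense, so `R` embeds `C` reflectively into presheaves on a
  -- small category.
  let : Reflective R := { L := L, adj := adj }
  exact hasLimits_of_reflective R

/-- Every object of a locally `κ`-presentable category is a colimit of `κ`-presentable objects
indexed by a `κ`-directed poset. -/
lemma exists_directed_presentation {C : Type u} [Category.{w} C]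
    (κ : Cardinal.{w}) [Fact κ.IsRegular] [IsCardinalLocallyPresentable C κ] (A : C) :
    ∃ (J : Type w) (_ : PartialOrder J) (_ : IsCardinalFiltered J κ),
      Nonempty ((isCardinalPresentable C κ).ColimitOfShape J A) := by
  obtain ⟨J, _, _, ⟨p⟩⟩ :=
    (isCardinalFilteredGenerator_isCardinalPresentable C κ).exists_colimitsOfShape A
  obtain ⟨α, _, _, G, _⟩ := IsCardinalFiltered.exists_cardinal_directed J κ
  exact ⟨α, inferInstance, inferInstance, ⟨p.reindex G⟩⟩

lemma isCardinalPresentable_pushout {C : Type u} [Category.{w} C]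
    (κ : Cardinal.{w}) [Fact κ.IsRegular] [HasPushouts C] {X Y Z : C} (f : X ⟶ Y) (g : X ⟶ Z)
    (hX : IsCardinalPresentable X κ) (hY : IsCardinalPresentable Y κ)
    (hZ : IsCardinalPresentable Z κ) : IsCardinalPresentable (pushout f g) κ := by
  have : ∀ k, IsCardinalPresentable ((span f g).obj k) κ := by
    rintro (_ | _ | _) <;> assumption
  refine isCardinalPresentable_of_isColimit _ (colimit.isColimit (span f g)) κ ?_
  exact (hasCardinalLT_of_finite _ _ (Cardinal.IsRegular.aleph0_le Fact.out))

/-! ### Cokernels of maps of representables -/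

/-- The functor `C ⥤ Ab` sending `A` to the cokernel of `Hom(Y, A) ⟶ Hom(X, A)`. -/
def cokernelFunctor {C : Type u} [Category.{w} C] [Preadditive C] {X Y : C} (g : X ⟶ Y) :
    C ⥤ AddCommGrpCat.{w} where
  obj A := .of ((X ⟶ A) ⧸ (Preadditive.leftComp A g).range)
  map {A B} f := AddCommGrpCat.ofHom (QuotientAddGroup.map _ _ (Preadditive.rightComp X f) (by
    rintro _ ⟨b, rfl⟩
    exact ⟨b ≫ f, (Category.assoc g b f).symm⟩))
  map_id A := by
    ext x
    exact congrArg QuotientAddGroup.mk (Category.comp_id x)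
  map_comp f g := by
    ext x
    exact congrArg QuotientAddGroup.mk (Category.assoc x f g).symm

section

variable {C : Type u} [Category.{w} C] [Preadditive C] {X Y : C} (g : X ⟶ Y)

/-- The class of a morphism in the cokernel. -/
def cokernelFunctor.mk {A : C} (a : X ⟶ A) : (cokernelFunctor g).obj A :=
  QuotientAddGroup.mk a

lemma cokernelFunctor.mk_surjective {A : C} (x : (cokernelFunctor g).obj A) :
    ∃ a, mk g a = x := QuotientAddGroup.mk_surjective x

lemma cokernelFunctor.mk_eq_mk_iff {A : C} (a a' : X ⟶ A) :
    mk g a = mk g a' ↔ ∃ b : Y ⟶ A, a' = a + g ≫ b := by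
  refine QuotientAddGroup.eq.trans ⟨?_, ?_⟩
  · rintro ⟨b, hb⟩
    exact ⟨b, by rw [show g ≫ b = -a + a' from hb]; abel⟩
  · rintro ⟨b, rfl⟩
    exact ⟨b, (neg_add_cancel_left a (g ≫ b)).symm⟩

lemma cokernelFunctor.isZero_obj_iff (A : C) :
    IsZero ((cokernelFunctor g).obj A) ↔ ∀ a : X ⟶ A, ∃ b : Y ⟶ A, g ≫ b = a := by
  rw [AddCommGrpCat.isZero_iff_subsingleton]
  constructor
  · intro _ a
    obtain ⟨b, hb⟩ := (mk_eq_mk_iff g 0 a).1 (Subsingleton.elim _ _)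
    exact ⟨b, by simp [hb]⟩
  · intro h
    refine ⟨fun x y => ?_⟩
    obtain ⟨a, rfl⟩ := mk_surjective g x
    obtain ⟨a', rfl⟩ := mk_surjective g y
    obtain ⟨b, hb⟩ := h (a' - a)
    exact (mk_eq_mk_iff g a a').2 ⟨b, by simp [hb]⟩

/-- Products are exact in `Ab`: representatives and correction terms are chosen coordinatewise. -/
lemma cokernelFunctor.preservesLimitsOfShape_discrete (ι : Type w) :
    PreservesLimitsOfShape (Discrete ι) (cokernelFunctor g) := by
  refine ⟨fun {K} => ⟨fun {c} hc => ⟨?_⟩⟩⟩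
  apply isLimitOfReflects (forget AddCommGrpCat.{w})
  refine ((Types.isLimit_iff _).2 fun s _ => ?_).some
  choose u hu using fun j => mk_surjective g (A := K.obj j) (s j)
  let lift {Z : C} (u : ∀ j, Z ⟶ K.obj j) : Z ⟶ c.pt :=
    hc.lift ⟨Z, Discrete.natTrans u⟩
  have fac {Z : C} (u : ∀ j, Z ⟶ K.obj j) j : lift u ≫ c.π.app j = u j :=
    hc.fac ⟨Z, Discrete.natTrans u⟩ j
  refine ⟨mk g (lift u), fun j => ?_, fun x hx => ?_⟩
  · refine Eq.trans ?_ (hu j)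
    exact congrArg (mk g) (fac u j)
  · obtain ⟨a, rfl⟩ := mk_surjective g (A := c.pt) x
    have h j : ∃ b, u j = a ≫ c.π.app j + g ≫ b :=
      (mk_eq_mk_iff g _ _).1 ((hx j).trans (hu j).symm)
    choose b hb using h
    refine (mk_eq_mk_iff g _ _).2 ⟨lift b, hc.hom_ext fun j => ?_⟩
    simp [fac, hb]

/-- A representative, a correction term `b` and the equation between them all descend to some stage
of the colimit. -/
lemma cokernelFunctor.preservesColimitsOfShape (κ : Cardinal.{w}) [Fact κ.IsRegular]
    [IsCardinalPresentable X κ] [IsCardinalPresentable Y κ]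
    (J : Type w) [SmallCategory J] [IsCardinalFiltered J κ] :
    PreservesColimitsOfShape J (cokernelFunctor g) := by
  have := isFiltered_of_isCardinalFiltered J κ
  have : ReflectsColimitsOfShape J (forget AddCommGrpCat.{w}) :=
    reflectsColimitsOfShape_of_reflectsIsomorphisms
  refine ⟨fun {K} => ⟨fun {c} hc => ⟨?_⟩⟩⟩
  apply isColimitOfReflects (forget AddCommGrpCat.{w})
  refine Types.FilteredColimit.isColimitOf' _ _ (fun x => ?_) (fun i x y h => ?_)
  · obtain ⟨a, rfl⟩ := mk_surjective g (A := c.pt) x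
    obtain ⟨j, a', rfl⟩ := IsCardinalPresentable.exists_hom_of_isColimit κ hc a
    exact ⟨j, mk g a', rfl⟩
  · obtain ⟨a, rfl⟩ := mk_surjective g (A := K.obj i) x
    obtain ⟨a', rfl⟩ := mk_surjective g (A := K.obj i) y
    obtain ⟨b, hb⟩ := (mk_eq_mk_iff g (a ≫ c.ι.app i) (a' ≫ c.ι.app i)).1 h
    obtain ⟨j, b', rfl⟩ := IsCardinalPresentable.exists_hom_of_isColimit κ hc b
    obtain ⟨l, t, ht⟩ := IsCardinalPresentable.exists_eq_of_isColimit' κ hc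
      (a' ≫ K.map (IsFiltered.leftToMax i j))
      (a ≫ K.map (IsFiltered.leftToMax i j) + g ≫ b' ≫ K.map (IsFiltered.rightToMax i j))
      (by simpa using hb)
    refine ⟨l, IsFiltered.leftToMax i j ≫ t, ?_⟩
    refine (mk_eq_mk_iff g (a ≫ K.map _) (a' ≫ K.map _)).2
      ⟨b' ≫ K.map (IsFiltered.rightToMax i j ≫ t), ?_⟩
    simpa using ht

lemma cokernelFunctor.isFun (κ : Cardinal.{w}) [Fact κ.IsRegular]
    [IsCardinalPresentable X κ] [IsCardinalPresentable Y κ] :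
    IsFun κ (cokernelFunctor g) where
  preserves_directed_colimits J _ _ := preservesColimitsOfShape g κ J
  preserves_products ι := preservesLimitsOfShape_discrete g ι

end

/-! ### Definable classes as injectivity classes -/

section

variable {C : Type u} [Category.{w} C]

/-- The tails `j ↦ ∏ B i`, indexed by those `i` above `j` satisfying `S`, with the projections as
transition maps. -/
noncomputable def tailProduct [HasProducts.{w} C] {J : Type w} [PartialOrder J] {S : J → Prop}
    (B : Subtype S → C) : J ⥤ C where
  obj j := ∏ᶜ fun i : { i : Subtype S // j ≤ i.1 } => B i.1
  map {j k} t := Pi.lift fun i => Pi.π (fun i : { i : Subtype S // j ≤ i.1 } => B i.1)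
    ⟨i.1, (leOfHom t).trans i.2⟩

/-- The projections of a tail product. -/
noncomputable def tailProduct.π [HasProducts.{w} C] {J : Type w} [PartialOrder J] {S : J → Prop}
    (B : Subtype S → C) {j : J} (i : Subtype S) (h : j ≤ i.1) : (tailProduct B).obj j ⟶ B i :=
  Pi.π (fun i : { i : Subtype S // j ≤ i.1 } => B i.1) ⟨i, h⟩

lemma tailProduct.map_π [HasProducts.{w} C] {J : Type w} [PartialOrder J] {S : J → Prop}
    (B : Subtype S → C) {j k : J} (t : j ⟶ k) (i : Subtype S) (h : k ≤ i.1) :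
    (tailProduct B).map t ≫ π B i h = π B i ((leOfHom t).trans h) :=
  Pi.lift_π _ _

variable (κ : Cardinal.{w}) [Fact κ.IsRegular] [IsCardinalLocallyPresentable C κ]

/-- If `A` is injective with respect to all morphisms between `κ`-presentable objects for which
`D` is injective, then a morphism `a : X ⟶ A` not factoring through `g` stays so after composing
with a suitable morphism to an object of `D`. -/
lemma exists_hom_not_factoring {D : ObjectProperty C} (hD : IsDefinable κ D) {A : C}
    (hA : ∀ ⦃X Y : C⦄ (g : X ⟶ Y), IsCardinalPresentable X κ → IsCardinalPresentable Y κ →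
      (∀ B, D B → ∀ a : X ⟶ B, ∃ b : Y ⟶ B, g ≫ b = a) → ∀ a : X ⟶ A, ∃ b : Y ⟶ A, g ≫ b = a)
    {X Y : C} (g : X ⟶ Y) (hX : IsCardinalPresentable X κ) (hY : IsCardinalPresentable Y κ)
    (a : X ⟶ A) (ha : ¬ ∃ b : Y ⟶ A, g ≫ b = a) :
    ∃ (B : C) (_ : D B) (h : A ⟶ B), ¬ ∃ b : Y ⟶ B, g ≫ b = a ≫ h := by
  have := hasLimitsOfSize_of_isCardinalLocallyPresentable C κ
  have : HasPushouts C := by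
    have := hasColimitsOfSizeShrink.{0, 0, w, w} C
    infer_instance
  obtain ⟨J, _, _, ⟨p⟩⟩ := exists_directed_presentation κ A
  have := isFiltered_of_isCardinalFiltered J κ
  obtain ⟨i₀, a₀, rfl⟩ := IsCardinalPresentable.exists_hom_of_isColimit κ p.isColimit a
  have key (i : { i // i₀ ≤ i }) : ∃ (B : C) (_ : D B) (u : p.diag.obj i.1 ⟶ B),
      ¬ ∃ b : Y ⟶ B, g ≫ b = a₀ ≫ p.diag.map (homOfLE i.2) ≫ u := by
    -- Otherwise `D` is injective for the pushout of `g` along `X ⟶ p.diag.obj i`, hence so is `A`,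
    -- and `a` would factor through `g`.
    by_contra! h
    have hi : IsCardinalPresentable (p.diag.obj i.1) κ := p.prop_diag_obj i.1
    obtain ⟨b, hb⟩ := hA (pushout.inr g (a₀ ≫ p.diag.map (homOfLE i.2))) hi
      (isCardinalPresentable_pushout κ _ _ hX hY hi) (fun B hB u => by
        obtain ⟨b, hb⟩ := h B hB u
        exact ⟨pushout.desc b u (by rw [hb, Category.assoc]), pushout.inr_desc _ _ _⟩) (p.ι.app i.1)
    refine ha ⟨pushout.inl _ _ ≫ b, ?_⟩
    rw [pushout.condition_assoc, hb]
    simp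
  choose B hB u hu using key
  -- The `u i` need not be compatible in `i`; mapping into tail products makes them natural, and the
  -- colimit `T` yields is a reduced product.
  let T := tailProduct B
  let v (j : J) : p.diag.obj j ⟶ T.obj j :=
    Pi.lift fun i => p.diag.map (homOfLE i.2) ≫ u i.1
  have hv (j : J) i (h : j ≤ i.1) :
      v j ≫ tailProduct.π B i h = p.diag.map (homOfLE h) ≫ u i := Pi.lift_π _ _
  let φ : p.diag ⟶ T :=
    { app := v
      naturality j k t := by
        refine Pi.hom_ext _ _ fun i => ?_
        change (_ ≫ v k) ≫ tailProduct.π B i.1 i.2 = (v j ≫ T.map t) ≫ tailProduct.π B i.1 i.2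
        rw [Category.assoc, Category.assoc, hv, tailProduct.map_π, hv, ← Functor.map_comp_assoc]
        rfl }
  refine ⟨colimit T, ?_, p.isColimit.desc ((Cocone.precompose φ).obj (colimit.cocone T)), ?_⟩
  · have := hD.closed_directed_colimits J
    refine D.prop_colimit _ fun j => ?_
    have := hD.closed_products { i : { i // i₀ ≤ i } // j ≤ i.1 }
    exact D.prop_limit _ fun i => hB _
  · rintro ⟨b, hb⟩
    have hfac := p.isColimit.fac ((Cocone.precompose φ).obj (colimit.cocone T)) i₀
    obtain ⟨j, b', rfl⟩ :=
      IsCardinalPresentable.exists_hom_of_isColimit κ (colimit.isColimit T) b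
    obtain ⟨k, s, t, hst⟩ := IsCardinalPresentable.exists_eq_of_isColimit κ (colimit.isColimit T)
      (a₀ ≫ φ.app i₀) (g ≫ b') (by
        rw [Category.assoc, Category.assoc, hb, Category.assoc]
        exact congrArg (a₀ ≫ ·) hfac.symm)
    -- The coordinate `k` survives at stage `k`, and there the factorization contradicts `hu`.
    have := hst =≫ tailProduct.π B ⟨k, leOfHom s⟩ le_rfl
    simp only [Category.assoc, T, φ, tailProduct.map_π, hv] at this
    refine hu ⟨k, leOfHom s⟩ ⟨_, this.symm.trans ?_⟩
    rfl

/-- A definable subcategory contains each object that is injective with respect to all morphisms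
between `κ`-presentable objects for which the subcategory is injective. -/
lemma IsDefinable.prop_of_injective {D : ObjectProperty C} (hD : IsDefinable κ D) {A : C}
    (hA : ∀ ⦃X Y : C⦄ (g : X ⟶ Y), IsCardinalPresentable X κ → IsCardinalPresentable Y κ →
      (∀ B, D B → ∀ a : X ⟶ B, ∃ b : Y ⟶ B, g ≫ b = a) →
        ∀ a : X ⟶ A, ∃ b : Y ⟶ A, g ≫ b = a) : D A := by
  have := hasLimitsOfSize_of_isCardinalLocallyPresentable C κ
  let E := SmallModel.{w} (isCardinalPresentable C κ).FullSubcategory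
  let e := equivSmallModel.{w} (isCardinalPresentable C κ).FullSubcategory
  let N : E ⥤ C := e.inverse ⋙ (isCardinalPresentable C κ).ι
  have hN (x : E) : IsCardinalPresentable (N.obj x) κ := (e.inverse.obj x).property
  have exists_iso (X : C) (hX : IsCardinalPresentable X κ) : ∃ x : E, Nonempty (N.obj x ≅ X) :=
    ⟨e.functor.obj ⟨X, hX⟩,
      ⟨(isCardinalPresentable C κ).ι.mapIso (e.unitIso.symm.app ⟨X, hX⟩)⟩⟩
  -- Representatives up to isomorphism keep the index type in `Type w`, so the product over it
  -- exists.
  let I := Σ x y : E, { q : (N.obj x ⟶ N.obj y) × (N.obj x ⟶ A) // ¬ ∃ b, q.1 ≫ b = q.2 }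
  choose B hB h hh using fun q : I =>
    exists_hom_not_factoring κ hD hA q.2.2.1.1 (hN _) (hN _) q.2.2.1.2 q.2.2.2
  have := hD.closed_products I
  refine hD.closed_pure_subobjects (Pi.lift h) ?_ (D.prop_limit (Discrete.functor B) fun i => hB _)
  rintro X Y g hX hY a ⟨b, hb⟩
  by_contra hc
  obtain ⟨x, ⟨ex⟩⟩ := exists_iso X hX
  obtain ⟨y, ⟨ey⟩⟩ := exists_iso Y hY
  let q : I := ⟨x, y, (ex.hom ≫ g ≫ ey.inv, ex.hom ≫ a), by
    rintro ⟨b, hb⟩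
    exact hc ⟨ey.inv ≫ b, by simpa using hb⟩⟩
  refine hh q ⟨ey.hom ≫ b ≫ Pi.π _ q, ?_⟩
  simp [q, reassoc_of% hb]

/-! ### Zero classes are definable -/

/-- A functor preserving `κ`-directed colimits sends `κ`-pure morphisms to monomorphisms. -/
lemma IsPure.map_injective {F : C ⥤ AddCommGrpCat.{w}} (hF : IsFun κ F) {A B : C} {f : A ⟶ B}
    (hf : IsPure κ f) : Function.Injective (F.map f) := by
  rw [injective_iff_map_eq_zero]
  intro x hx
  obtain ⟨J, _, _, ⟨p⟩⟩ := exists_directed_presentation κ A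
  obtain ⟨J', _, _, ⟨p'⟩⟩ := exists_directed_presentation κ B
  have := isFiltered_of_isCardinalFiltered J κ
  have := isFiltered_of_isCardinalFiltered J' κ
  have := hF.preserves_directed_colimits J
  have := hF.preserves_directed_colimits J'
  obtain ⟨i, x, rfl⟩ := Types.jointly_surjective_of_isColimit
    (isColimitOfPreserves (F ⋙ forget _) p.isColimit) x
  change F.map (p.ι.app i) x = 0
  replace hx : F.map f (F.map (p.ι.app i) x) = 0 := hx
  have hi : IsCardinalPresentable (p.diag.obj i) κ := p.prop_diag_obj i
  obtain ⟨j, g, hg⟩ :=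
    IsCardinalPresentable.exists_hom_of_isColimit κ p'.isColimit (p.ι.app i ≫ f)
  obtain ⟨k, t, ht⟩ := (Types.FilteredColimit.isColimit_eq_iff'
    (isColimitOfPreserves (F ⋙ forget _) p'.isColimit) (i := j) (F.map g x)
    (0 : F.obj (p'.diag.obj j))).1 (by
      change F.map (p'.ι.app j) (F.map g x) = F.map (p'.ι.app j) 0
      rw [map_zero, ← hx, ← ConcreteCategory.comp_apply, ← ConcreteCategory.comp_apply,
        ← F.map_comp, ← F.map_comp, ← hg])
  replace ht : F.map (p'.diag.map t) (F.map g x) = F.map (p'.diag.map t) 0 := ht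
  -- By purity `p.ι.app i` factors through `p.diag.obj i ⟶ p'.diag.obj k`, whose image under `F`
  -- already kills `x`.
  obtain ⟨c, hc⟩ := hf (g ≫ p'.diag.map t) hi (p'.prop_diag_obj k) (p.ι.app i)
    ⟨p'.ι.app k, by rw [← hg]; simp⟩
  rw [← hc, F.map_comp, F.map_comp, ConcreteCategory.comp_apply, ConcreteCategory.comp_apply, ht]
  simp

lemma isDefinable_of_isZero (𝓕 : ObjectProperty (FunCat C κ)) :
    IsDefinable κ (fun X : C => ∀ F : FunCat C κ, 𝓕 F → IsZero (F.obj.obj X)) where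
  closed_products ι := ⟨by
    rintro X ⟨p⟩ F hF
    have := F.property.preserves_products ι
    exact IsLimit.isZero_pt (isLimitOfPreserves F.obj p.isLimit)
      (Functor.isZero _ fun j => p.prop_diag_obj j F hF)⟩
  closed_directed_colimits J _ _ := ⟨by
    rintro X ⟨p⟩ F hF
    have := F.property.preserves_directed_colimits J
    exact IsColimit.isZero_pt (isColimitOfPreserves F.obj p.isColimit)
      (Functor.isZero _ fun j => p.prop_diag_obj j F hF)⟩
  closed_pure_subobjects A B f hf hB F hF := by
    have h := hB F hF
    rw [AddCommGrpCat.isZero_iff_subsingleton] at h ⊢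
    exact (hf.map_injective κ F.property).subsingleton

end

end LambdaDefinable

theorem mainTheorem5 {C : Type u} [Category.{w} C] [Preadditive C] [HasFiniteBiproducts C]
    (κ : Cardinal.{w}) [Fact κ.IsRegular] [IsCardinalLocallyPresentable C κ]
    (D : ObjectProperty C) :
    LambdaDefinable.IsDefinable κ D ↔
      ∃ 𝓕 : ObjectProperty (LambdaDefinable.FunCat C κ),
        ∀ X : C, D X ↔ ∀ F : LambdaDefinable.FunCat C κ, 𝓕 F → IsZero (F.obj.obj X) := by
  constructor
  · intro hD
    -- The largest candidate: all functors vanishing on `D`.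
    refine ⟨fun F => ∀ B, D B → IsZero (F.obj.obj B),
      fun A => ⟨fun hA F hF => hF A hA, fun hA => ?_⟩⟩
    refine hD.prop_of_injective κ fun X Y g hX hY hg => ?_
    rw [← LambdaDefinable.cokernelFunctor.isZero_obj_iff]
    exact hA ⟨LambdaDefinable.cokernelFunctor g, LambdaDefinable.cokernelFunctor.isFun g κ⟩ fun B hB =>
      (LambdaDefinable.cokernelFunctor.isZero_obj_iff g B).2 (hg B hB)
  · rintro ⟨𝓕, h𝓕⟩
    obtain rfl : D = _ := funext fun X => propext (h𝓕 X)
    exact LambdaDefinable.isDefinable_of_isZero κ 𝓕
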